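/- For a topological space $X$ let $S(X)$ be its singular simplicial set and $X^\bullet=|S(X)|$ the geometric realization. Let $G$ be a topological group with identity $e$ and $H$ a subgroup of $G$ (with the subspace topology). The simplicial group $S(H)$ acts on $S(G)$ by right multiplication; let $G//H=|S(G)/S(H)|$ be the geometric realization of the simplicial set of orbits, and let $p:G^\bullet\to G//H$ be the projection, i.e. the realization of the quotient map $S(G)\to S(G)/S(H)$. Write $e\in G^\bullet$ also for the vertex given by the identity of $G$. A path-connected space $X$ having a universal covering (for instance a CW complex) is called strongly simple if (i) $X$ is simple, that is, for every $x\in X$ and $n\ge 1$ the group $\pi_1(X,x)$ acts trivially on $\pi_n(X,x)$ (in particular $\pi_1(X,x)$ is abelian), and (ii) $\pi_1(X)$, acting by covering transformations, acts trivially on the integral singular homology of the universal covering space of $X$ (equivalently, the fibration $X\to K(\pi_1(X),1)$ is orientable). **Proposition 3.4.** Assume that $\pi_1(p):\pi_1(G^\bullet,e)\to\pi_1(G//H,p(e))$ is onto. Then $G//H$ is strongly simple, in the sense that each of its path components is strongly simple. In particular, $G//H$ is strongly simple if it is path-connected. -/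

import Mathlib

open CategoryTheory Simplicial Opposite

universe u

noncomputable section

/-! ### The simplicial quotient of a topological group by a subgroup -/

namespace SimplicialQuotient

variable {G : Type u} [Group G] [TopologicalSpace G]

/-- The value of a singular simplex `σ : Δⁿ → X` at a point of the standard simplex. -/
abbrev ev {X : Type u} [TopologicalSpace X] {n : SimplexCategoryᵒᵖ}
    (σ : (TopCat.toSSet.obj (TopCat.of X)).obj n)
    (t : stdSimplex ℝ (Fin (n.unop.len + 1))) : X :=
  TopCat.toSSetObjEquiv (TopCat.of X) n σ t

/-- The orbit relation of the right action of `S(H)ₙ` on `S(G)ₙ` by pointwise multiplication: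
`σ ∼ τ` iff `τ = σ · η` for some singular simplex `η : Δⁿ → H`. -/
def orbitSetoid [IsTopologicalGroup G] (H : Subgroup G) (n : SimplexCategoryᵒᵖ) :
    Setoid ((TopCat.toSSet.obj (TopCat.of G)).obj n) where
  r σ τ := ∃ η : (TopCat.toSSet.obj (TopCat.of H)).obj n, ∀ t, ev τ t = ev σ t * ((ev η t : H) : G)
  iseqv :=
    { refl := fun σ => ⟨(TopCat.toSSetObjEquiv (TopCat.of H) n).symm ⟨fun _ => (1 : H),
          continuous_const⟩, fun t => by simp [ev]⟩
      symm := by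
        rintro σ τ ⟨η, h⟩
        refine ⟨(TopCat.toSSetObjEquiv (TopCat.of H) n).symm ⟨fun t => (ev η t)⁻¹,
          (TopCat.toSSetObjEquiv (TopCat.of H) n η).continuous.inv⟩, fun t => ?_⟩
        have e : ev ((TopCat.toSSetObjEquiv (TopCat.of H) n).symm ⟨fun t => (ev η t)⁻¹,
          (TopCat.toSSetObjEquiv (TopCat.of H) n η).continuous.inv⟩) t = (ev η t)⁻¹ := by
          simp [ev]
        rw [e, h t]
        simp
      trans := by
        rintro σ τ ρ ⟨η, h⟩ ⟨θ, k⟩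
        refine ⟨(TopCat.toSSetObjEquiv (TopCat.of H) n).symm ⟨fun t => ev η t * ev θ t,
          (TopCat.toSSetObjEquiv (TopCat.of H) n η).continuous.mul
            (TopCat.toSSetObjEquiv (TopCat.of H) n θ).continuous⟩, fun t => ?_⟩
        have e : ev ((TopCat.toSSetObjEquiv (TopCat.of H) n).symm ⟨fun t => ev η t * ev θ t,
          (TopCat.toSSetObjEquiv (TopCat.of H) n η).continuous.mul
            (TopCat.toSSetObjEquiv (TopCat.of H) n θ).continuous⟩) t = ev η t * ev θ t := by
          simp [ev]
        rw [e, k t, h t]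
        simp [mul_assoc] }

/-- The simplicial set `S(G)/S(H)`. -/
def quotSSet [IsTopologicalGroup G] (H : Subgroup G) : SSet.{u} where
  obj n := Quotient (orbitSetoid H n)
  map {m n} f := TypeCat.ofHom (Quotient.map ((TopCat.toSSet.obj (TopCat.of G)).map f) (by
    rintro σ τ ⟨η, h⟩
    exact ⟨(TopCat.toSSet.obj (TopCat.of H)).map f η, fun t => h (stdSimplex.map f.unop t)⟩))
  map_id n := by
    ext x
    induction x using Quotient.inductionOn with
    | h σ => simp
  map_comp f g := by
    ext x
    induction x using Quotient.inductionOn with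
    | h σ => simp

/-- The quotient map `S(G) → S(G)/S(H)`. -/
def quotSSetMap [IsTopologicalGroup G] (H : Subgroup G) :
    TopCat.toSSet.obj (TopCat.of G) ⟶ quotSSet H where
  app n := TypeCat.ofHom (fun σ => Quotient.mk (orbitSetoid H n) σ)
  naturality m n f := by
    ext σ
    rfl

/-- The point of the geometric realization `|K|` given by a vertex of the simplicial set `K`. -/
def vertex (K : SSet.{u}) (v : K _⦋0⦌) : SSet.toTop.obj K :=
  TopCat.toSSetObj₀Equiv ((sSetTopAdj.unit.app K).app (op ⦋0⦌) v)

variable (G) in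
/-- `G^• = |S(G)|`. -/
abbrev singularRealization : TopCat.{u} := SSet.toTop.obj (TopCat.toSSet.obj (TopCat.of G))

variable (G) in
/-- The base point of `G^• = |S(G)|`: the vertex given by the identity element of `G`. -/
def basePoint : singularRealization G :=
  vertex _ (TopCat.toSSetObj₀Equiv.symm (1 : G))

/-- The simplicial quotient `G//H = |S(G)/S(H)|`. -/
abbrev simplicialQuotient [IsTopologicalGroup G] (H : Subgroup G) : TopCat.{u} :=
  SSet.toTop.obj (quotSSet H)

/-- The projection `p : G^• → G//H`. -/
def proj [IsTopologicalGroup G] (H : Subgroup G) :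
    C(singularRealization G, simplicialQuotient H) :=
  (SSet.toTop.map (quotSSetMap H)).hom

end SimplicialQuotient

/-! ### Strongly simple spaces -/

section StronglySimple

open scoped unitInterval


/-- `[g]` is the result of transporting `[f] ∈ πₙ(X, x)` along the loop `γ`: there is a homotopy
from `f` to `g` through maps of the cube whose value on the boundary of the cube at time `t` is
constantly `γ t`. -/
def FreelyHomotopicAlong {X : Type u} [TopologicalSpace X] {x : X} {n : ℕ} (γ : Path x x)
    (f g : GenLoop (Fin n) X x) : Prop :=
  ∃ F : ContinuousMap.Homotopy (f : C(Fin n → I, X)) (g : C(Fin n → I, X)),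
    ∀ (t : I), ∀ y ∈ Cube.boundary (Fin n), F (t, y) = γ t

/-- `X` is simple: `π₁(X, x)` acts trivially on `πₙ(X, x)` for all `x` and all `n ≥ 1`.
(For `n = 1` the action is by conjugation, so that `π₁(X, x)` is abelian.) -/
def IsSimpleSpace (X : Type u) [TopologicalSpace X] : Prop :=
  ∀ (x : X) (n : ℕ), 1 ≤ n → ∀ (γ : Path x x) (f g : GenLoop (Fin n) X x),
    FreelyHomotopicAlong γ f g → GenLoop.Homotopic f g

/-- Every covering transformation of a universal (that is, simply connected) covering space of `X`
induces the identity on integral singular homology. -/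
def DeckActsTriviallyOnHomology (X : Type u) [TopologicalSpace X] : Prop :=
  ∀ (E : Type u) [TopologicalSpace E] [SimplyConnectedSpace E] (q : E → X), IsCoveringMap q →
    ∀ φ : E ≃ₜ E, (∀ e, q (φ e) = q e) → ∀ n : ℕ,
      ((AlgebraicTopology.singularHomologyFunctor AddCommGrpCat.{u} n).obj
        (AddCommGrpCat.of (ULift.{u} ℤ))).map (TopCat.ofHom (φ : C(E, E))) = 𝟙 _

/-- A path-connected space (with a universal covering, for instance a CW complex) is strongly
simple if it is simple and its fundamental group, acting by covering transformations, acts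
trivially on the integral homology of its universal covering. Equivalently, the last condition
says that the fibration `X → K(π₁(X), 1)` with fiber the universal covering is orientable. -/
structure IsStronglySimple (X : Type u) [TopologicalSpace X] : Prop where
  pathConnected : PathConnectedSpace X
  simple : IsSimpleSpace X
  homology_trivial : DeckActsTriviallyOnHomology X

end StronglySimple

end

/-!
The heart of the matter is a property, going back to Gottlieb, which `G//H` has if `π₁(p)` is onto:
every loop `γ` in `G//H` is, up to homotopy, the trace `t ↦ Γ (t, x)` of its base point `x` under a
homotopy `Γ` from the identity of `G//H` to itself (`IsGottliebLoop`).

Such homotopies come from the left action of `S(G)` on `S(G)/S(H)`. A loop `γ'` at `e` in `G^•` acts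
on `G//H` by `Γ (t, z) = γ' t · z`; as `e` acts as the identity, this is a self-homotopy of the
identity, and it moves `p(e)` along `p ∘ γ'` (`SimplicialQuotient.isGottliebLoop_map_proj`). By
hypothesis every loop at `p(e)` is homotopic to some `p ∘ γ'`. The elements of `G` act on `G//H` by
homeomorphisms which permute the vertices transitively, and every point is joined to a vertex, so
all loops at all points are Gottlieb loops (`SimplicialQuotient.isGottliebLoop_of_surjective`).

The continuity of `Γ` needs part of the compatibility of realization with products. A product of
two simplices is covered by finitely many simplices, one for each pair of monotone maps with
common source; since it is a quotient of their disjoint union, the pairing of an `m`-simplex with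
an `n`-simplex realizes to a continuous map on the product
(`SimplicialPairing.exists_prodMap`). It is well defined because two descriptions of the same
point have a common refinement, in which the point is interior, and an interior point determines
the monotone maps. Currying then extends the pairing from simplices to realizations, along a path
in the first factor (`SimplicialPairing.exists_pathAction`).

If all loops of a space `X` are Gottlieb loops, then the path components of `X` are strongly simple.
* A free homotopy `F` of maps of cubes along `γ` becomes, when moved to `Γ (1 - t, F (t, y))`, a free
  homotopy along a null-homotopic loop, hence can be made relative to the boundary
  (`isSimpleSpace_of_isGottliebLoop`).
* A deck transformation `φ` of the universal covering is homotopic to the identity: project a path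
  from a point `e` to `φ e` to a loop, and lift the corresponding homotopy `Γ`
  (`homotopic_id_of_isGottliebLoop`). Homotopy invariance of singular homology does the rest.
-/

noncomputable section

/-! ### Gottlieb loops -/

section GottliebLoops

open scoped unitInterval

variable {X : Type u} [TopologicalSpace X]

/-- A loop `γ` at `x` is a *Gottlieb loop* if, up to homotopy, it is the trace `t ↦ Γ(t, x)` of
the point `x` under a homotopy `Γ : I × X → X` from the identity of `X` to itself. -/
def IsGottliebLoop {x : X} (γ : Path x x) : Prop :=
  ∃ (Γ : C(I × X, X)) (δ : Path x x), (∀ y, Γ (0, y) = y) ∧ (∀ y, Γ (1, y) = y) ∧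
    (∀ t, Γ (t, x) = δ t) ∧ δ.Homotopic γ

instance : ContractibleSpace I :=
  (convex_Icc (0 : ℝ) 1).contractibleSpace ⟨0, by simp⟩

/-- The two ways around the boundary of a square are homotopic. -/
theorem Path.homotopic_of_square (Ψ : C(I × I, X)) {x₀₀ x₁₀ x₀₁ x₁₁ : X}
    (a : Path x₀₀ x₁₀) (b : Path x₁₀ x₁₁) (c : Path x₀₀ x₀₁) (d : Path x₀₁ x₁₁)
    (ha : ∀ t, a t = Ψ (t, 0)) (hb : ∀ t, b t = Ψ (1, t))
    (hc : ∀ t, c t = Ψ (0, t)) (hd : ∀ t, d t = Ψ (t, 1)) :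
    (a.trans b).Homotopic (c.trans d) := by
  obtain rfl : Ψ (0, 0) = x₀₀ := by rw [← ha, a.source]
  obtain rfl : Ψ (1, 0) = x₁₀ := by rw [← ha, a.target]
  obtain rfl : Ψ (0, 1) = x₀₁ := by rw [← hd, d.source]
  obtain rfl : Ψ (1, 1) = x₁₁ := by rw [← hd, d.target]
  let pa : Path ((0, 0) : I × I) (1, 0) := ⟨⟨fun t => (t, 0), by fun_prop⟩, rfl, rfl⟩
  let pb : Path ((1, 0) : I × I) (1, 1) := ⟨⟨fun t => (1, t), by fun_prop⟩, rfl, rfl⟩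
  let pc : Path ((0, 0) : I × I) (0, 1) := ⟨⟨fun t => (0, t), by fun_prop⟩, rfl, rfl⟩
  let pd : Path ((0, 1) : I × I) (1, 1) := ⟨⟨fun t => (t, 1), by fun_prop⟩, rfl, rfl⟩
  obtain rfl : a = pa.map Ψ.continuous := by ext t; exact ha t
  obtain rfl : b = pb.map Ψ.continuous := by ext t; exact hb t
  obtain rfl : c = pc.map Ψ.continuous := by ext t; exact hc t
  obtain rfl : d = pd.map Ψ.continuous := by ext t; exact hd t
  rw [← Path.map_trans, ← Path.map_trans]
  exact (SimplyConnectedSpace.paths_homotopic _ _).map Ψ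

/-- The antidiagonal of a square runs, up to homotopy, along two of its sides. -/
theorem Path.homotopic_of_antidiagonal (Ψ : C(I × I, X)) {x₀₀ x₁₀ x₀₁ : X}
    (a : Path x₀₀ x₁₀) (c : Path x₀₀ x₀₁) (d : Path x₁₀ x₀₁)
    (ha : ∀ t, a t = Ψ (t, 0)) (hc : ∀ t, c t = Ψ (0, t)) (hd : ∀ t, d t = Ψ (σ t, t)) :
    d.Homotopic (a.symm.trans c) := by
  obtain rfl : Ψ (0, 0) = x₀₀ := by rw [← ha, a.source]
  obtain rfl : Ψ (1, 0) = x₁₀ := by rw [← ha, a.target]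
  obtain rfl : Ψ (0, 1) = x₀₁ := by rw [← hc, c.target]
  let pa : Path ((0, 0) : I × I) (1, 0) := ⟨⟨fun t => (t, 0), by fun_prop⟩, rfl, rfl⟩
  let pc : Path ((0, 0) : I × I) (0, 1) := ⟨⟨fun t => (0, t), by fun_prop⟩, rfl, rfl⟩
  let pd : Path ((1, 0) : I × I) (0, 1) :=
    ⟨⟨fun t => (σ t, t), by fun_prop⟩, by simp, by simp⟩
  obtain rfl : a = pa.map Ψ.continuous := by ext t; exact ha t
  obtain rfl : c = pc.map Ψ.continuous := by ext t; exact hc t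
  obtain rfl : d = pd.map Ψ.continuous := by ext t; exact hd t
  rw [Path.map_symm, ← Path.map_trans]
  exact (SimplyConnectedSpace.paths_homotopic _ _).map Ψ

/-- If every loop at `x` is a Gottlieb loop, then so is every loop at a point `y` joined to `x`:
the traces of `x` and `y` under a self-homotopy of the identity are conjugate along the path. -/
theorem isGottliebLoop_of_path {x y : X} (ℓ : Path x y)
    (hx : ∀ γ : Path x x, IsGottliebLoop γ) (γ : Path y y) : IsGottliebLoop γ := by
  obtain ⟨Γ, δ, h0, h1, hδ, hh⟩ := hx ((ℓ.trans γ).trans ℓ.symm)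
  let ε : Path y y := ⟨⟨fun t => Γ (t, y), by fun_prop⟩, h0 y, h1 y⟩
  refine ⟨Γ, ε, h0, h1, fun t => rfl, ?_⟩
  have sq : (δ.trans ℓ).Homotopic (ℓ.trans ε) := by
    refine Path.homotopic_of_square ⟨fun s => Γ (s.1, ℓ s.2), by fun_prop⟩ δ ℓ ℓ ε ?_ ?_ ?_ ?_
    · intro t; simp [hδ]
    · intro t; simp [h1]
    · intro t; simp [h0]
    · intro t; simp [ε]
  rw [← Path.Homotopic.Quotient.eq] at sq hh ⊢
  simp only [Path.Homotopic.Quotient.mk_trans, Path.Homotopic.Quotient.mk_symm] at sq hh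
  rw [hh, Path.Homotopic.Quotient.trans_assoc, Path.Homotopic.Quotient.symm_trans,
    Path.Homotopic.Quotient.trans_refl] at sq
  have := congrArg (Path.Homotopic.Quotient.trans (Path.Homotopic.Quotient.mk ℓ).symm) sq
  simpa [← Path.Homotopic.Quotient.trans_assoc] using this.symm

theorem isGottliebLoop_of_homeomorph {Y : Type u} [TopologicalSpace Y] (e : X ≃ₜ Y)
    {x : X} {y : Y} (hxy : e x = y) (hx : ∀ γ : Path x x, IsGottliebLoop γ) (γ : Path y y) :
    IsGottliebLoop γ := by
  subst hxy
  obtain ⟨Γ, δ, h0, h1, hδ, hh⟩ :=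
    hx ((γ.map e.symm.continuous).cast (e.symm_apply_apply x).symm (e.symm_apply_apply x).symm)
  refine ⟨⟨fun p => e (Γ (p.1, e.symm p.2)), by fun_prop⟩, δ.map e.continuous, ?_, ?_, ?_, ?_⟩
  · simp [h0]
  · simp [h1]
  · simp [hδ]
  · have := hh.map (e : C(X, Y))
    convert this using 1
    · simp
    · simp
    · apply Path.ext
      funext t
      exact (e.apply_symm_apply (γ t)).symm

/-- A self-homotopy of the identity of `X` preserves path components, so Gottlieb loops of `X`
are Gottlieb loops of a path component. -/
theorem isGottliebLoop_pathComponent (z : X) (hX : ∀ (x : X) (γ : Path x x), IsGottliebLoop γ)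
    (x : pathComponent z) (γ : Path x x) : IsGottliebLoop γ := by
  obtain ⟨Γ, δ, h0, h1, hδ, ⟨K⟩⟩ := hX x (γ.map continuous_subtype_val)
  have hΓ (t : I) (y : pathComponent z) : Γ (t, y) ∈ pathComponent z := by
    refine Joined.trans y.2 ⟨⟨⟨fun s => Γ (s * t, y), by fun_prop⟩, ?_, ?_⟩⟩ <;> simp [h0]
  have hδz (t : I) : δ t ∈ pathComponent z := hδ t ▸ hΓ t x
  have hK (p : I × I) : K p ∈ pathComponent z := by
    refine Joined.trans (hδz p.2) ⟨⟨⟨fun s => K (s * p.1, p.2), by fun_prop⟩, ?_, ?_⟩⟩ <;> simp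
  refine ⟨⟨fun p => ⟨Γ (p.1, p.2), hΓ _ _⟩, by fun_prop⟩,
    ⟨⟨fun t => ⟨δ t, hδz t⟩, by fun_prop⟩, Subtype.ext (by simp), Subtype.ext (by simp)⟩,
    fun y => Subtype.ext (h0 y), fun y => Subtype.ext (h1 y), fun t => Subtype.ext (hδ t), ⟨?_⟩⟩
  exact
    { toFun := fun p => ⟨K p, hK p⟩
      continuous_toFun := by fun_prop
      map_zero_left := fun t => Subtype.ext (K.map_zero_left t)
      map_one_left := fun t => Subtype.ext (K.map_one_left t)
      prop' := fun t s hs => Subtype.ext (K.prop t s hs) }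

/-! ### Transport along a null-homotopic loop -/

/-- The map of the interval stretching `[1/4, 3/4]` to the whole interval. -/
def stretch : C(I, I) :=
  ⟨fun s => Set.projIcc 0 1 zero_le_one (2 * (s : ℝ) - 1 / 2), by fun_prop⟩

/-- A bump function on the interval: `1` on `[1/4, 3/4]` and `0` at the end points. -/
def bump : C(I, I) :=
  ⟨fun s => Set.projIcc 0 1 zero_le_one (4 * min (s : ℝ) (1 - s)), by fun_prop⟩

theorem stretch_of_le {s : I} (h : (s : ℝ) ≤ 1 / 4) : stretch s = 0 :=
  Set.projIcc_of_le_left zero_le_one (by linarith)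

theorem stretch_of_ge {s : I} (h : 3 / 4 ≤ (s : ℝ)) : stretch s = 1 :=
  Set.projIcc_of_right_le zero_le_one (by linarith)

theorem bump_of_mem {s : I} (h₁ : 1 / 4 ≤ (s : ℝ)) (h₂ : (s : ℝ) ≤ 3 / 4) : bump s = 1 :=
  Set.projIcc_of_right_le zero_le_one 
    (by linarith [le_min h₁ (show 1 / 4 ≤ 1 - (s : ℝ) by linarith)])

theorem bump_zero : bump 0 = 0 := Set.projIcc_of_le_left zero_le_one (by simp)

theorem bump_one : bump 1 = 0 := Set.projIcc_of_le_left zero_le_one (by simp)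

/-- Precomposition with the stretching map does not change the class of a generalized loop. -/
theorem GenLoop.homotopic_of_stretch {n : ℕ} {x : X} (f g : GenLoop (Fin n) X x)
    (h : ∀ y, g y = f fun i => stretch (y i)) : GenLoop.Homotopic f g := by
  have mem (s a b : I) : (1 - (s : ℝ)) * a + s * b ∈ Set.Icc (0 : ℝ) 1 := by
    refine convex_Icc (0 : ℝ) 1 a.2 b.2 (by linarith [s.2.2]) s.2.1 (by ring)
  refine ⟨{ toFun := fun p =>
              f.1 fun i => ⟨(1 - (p.1 : ℝ)) * p.2 i + p.1 * stretch (p.2 i), mem _ _ _⟩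
            continuous_toFun := by fun_prop
            map_zero_left := fun y => by simp
            map_one_left := fun y => by simpa using (h y).symm
            prop' := ?_ }⟩
  rintro t y hy
  refine Eq.trans ?_ (f.2 y hy).symm
  refine f.2 _ ?_
  obtain ⟨i, hi⟩ := hy
  refine ⟨i, hi.imp ?_ ?_⟩
  · intro hi
    apply Subtype.ext
    simp [hi, stretch_of_le (s := 0) (by simp)]
  · intro hi
    apply Subtype.ext
    simp [hi, stretch_of_ge (s := 1) (by norm_num)]

/-- A free homotopy of generalized loops along a null-homotopic loop can be replaced by a homotopy
relative to the boundary. The null-homotopy is spread over a collar of the cube. -/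
theorem FreelyHomotopicAlong.homotopic_of_nullhomotopic {x : X} {n : ℕ} {δ : Path x x}
    {f g : GenLoop (Fin n) X x} (hfg : FreelyHomotopicAlong δ f g)
    (hδ : (Path.refl x).Homotopic δ) : GenLoop.Homotopic f g := by
  classical
  obtain ⟨F, hF⟩ := hfg
  obtain ⟨K⟩ := hδ
  -- `F` is used on the inner cube `A`, the null-homotopy `K` on the collar `B`; there the bump
  -- function `∏ i, bump (y i)` falls from `1` on the boundary of the inner cube to `0` on the
  -- boundary of the whole cube.
  let A : Set (I × (Fin n → I)) := ⋂ i, {p | 1 / 4 ≤ (p.2 i : ℝ)} ∩ {p | (p.2 i : ℝ) ≤ 3 / 4}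
  let B : Set (I × (Fin n → I)) := ⋃ i, {p | (p.2 i : ℝ) ≤ 1 / 4} ∪ {p | 3 / 4 ≤ (p.2 i : ℝ)}
  have mem_A {p} : p ∈ A ↔ ∀ i, 1 / 4 ≤ (p.2 i : ℝ) ∧ (p.2 i : ℝ) ≤ 3 / 4 := by
    simp [A]
  have mem_B {p} : p ∈ B ↔ ∃ i, (p.2 i : ℝ) ≤ 1 / 4 ∨ 3 / 4 ≤ (p.2 i : ℝ) := by
    simp [B]
  have hA : IsClosed A := isClosed_iInter fun i =>
    (isClosed_le (by fun_prop) (by fun_prop)).inter (isClosed_le (by fun_prop) (by fun_prop))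
  have hB : IsClosed B := isClosed_iUnion_of_finite fun i =>
    (isClosed_le (by fun_prop) (by fun_prop)).union (isClosed_le (by fun_prop) (by fun_prop))
  have hAB : A ∪ B = Set.univ := by
    ext p
    simp only [Set.mem_union, mem_A, mem_B, Set.mem_univ, iff_true]
    by_contra! h
    obtain ⟨⟨i, hi⟩, h2⟩ := h
    exact absurd (hi (h2 i).1.le) (by linarith [(h2 i).2])
  have hstr {p : I × (Fin n → I)} (hp : p ∈ B) :
      (fun i => stretch (p.2 i)) ∈ Cube.boundary (Fin n) := by
    obtain ⟨i, hi⟩ := mem_B.1 hp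
    exact ⟨i, hi.imp stretch_of_le stretch_of_ge⟩
  let inner : C(I × (Fin n → I), X) := ⟨fun p => F (p.1, fun i => stretch (p.2 i)), by fun_prop⟩
  let outer : C(I × (Fin n → I), X) := ⟨fun p => K (∏ i, bump (p.2 i), p.1), by fun_prop⟩
  have hio {p} (hpA : p ∈ A) (hpB : p ∈ B) : inner p = outer p := by
    have : ∏ i, bump (p.2 i) = 1 :=
      Finset.prod_eq_one fun i _ => bump_of_mem (mem_A.1 hpA i).1 (mem_A.1 hpA i).2
    simp only [inner, outer, ContinuousMap.coe_mk, this, hF _ _ (hstr hpB)]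
    exact (K.apply_one p.1).symm
  let E : I × (Fin n → I) → X := fun p => if p ∈ A then inner p else outer p
  have hEA {p} (hp : p ∈ A) : E p = inner p := if_pos hp
  have hEB {p} (hp : p ∈ B) : E p = outer p := by
    by_cases h : p ∈ A
    · rw [hEA h, hio h hp]
    · exact if_neg h
  have hEc : Continuous E := by
    rw [← continuousOn_univ, ← hAB]
    exact (inner.continuous.continuousOn.congr fun p hp => hEA hp).union_of_isClosed
      (outer.continuous.continuousOn.congr fun p hp => hEB hp) hA hB
  have hE_end (t : I) (ht : δ t = x) (hK : ∀ s, K (s, t) = x) (y : Fin n → I) :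
      E (t, y) = F (t, fun i => stretch (y i)) := by
    by_cases h : (t, y) ∈ A
    · exact hEA h
    · have hB : (t, y) ∈ B := (hAB ▸ Set.mem_univ (t, y) : (t, y) ∈ A ∪ B).resolve_left h
      rw [hEB hB, hF _ _ (hstr hB), ht]
      exact hK _
  have hbdr : ∀ y ∈ Cube.boundary (Fin n), (fun i => stretch (y i)) ∈ Cube.boundary (Fin n) := by
    rintro y ⟨i, hi⟩
    refine ⟨i, hi.imp (fun h => ?_) fun h => ?_⟩
    · exact stretch_of_le (by simp [h])
    · exact stretch_of_ge (by simp only [h, Set.Icc.coe_one]; norm_num)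
  let str (f : GenLoop (Fin n) X x) : GenLoop (Fin n) X x :=
    ⟨⟨fun y => f.1 fun i => stretch (y i), by fun_prop⟩, fun y hy => f.2 _ (hbdr y hy)⟩
  refine (GenLoop.homotopic_of_stretch f (str f) fun y => rfl).trans (GenLoop.Homotopic.trans ?_
    (GenLoop.homotopic_of_stretch g (str g) fun y => rfl).symm)
  refine ⟨{ toFun := E, continuous_toFun := hEc, map_zero_left := ?_, map_one_left := ?_,
            prop' := ?_ }⟩
  · intro y
    rw [hE_end 0 (by simp) (by simp), F.apply_zero]
    rfl
  · intro y
    rw [hE_end 1 (by simp) (by simp), F.apply_one]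
    rfl
  · intro t y hy
    have hprod : ∏ i, bump (y i) = 0 := by
      obtain ⟨i, hi⟩ := hy
      refine Finset.prod_eq_zero (Finset.mem_univ i) ?_
      rcases hi with hi | hi
      · rw [hi, bump_zero]
      · rw [hi, bump_one]
    have hB : (t, y) ∈ B := by
      obtain ⟨i, hi⟩ := hy
      exact mem_B.2 ⟨i, hi.imp (fun h => by simp [h]) fun h => by
        simp only [h, Set.Icc.coe_one]; norm_num⟩
    refine Eq.trans (hEB hB) (Eq.trans ?_ ((str f).2 y hy).symm)
    simp only [outer, ContinuousMap.coe_mk, hprod]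
    exact K.apply_zero t

/-! ### Spaces all of whose loops are Gottlieb loops -/

/-- Moving a free homotopy along `γ` by the inverse of a self-homotopy of the identity with trace
`γ` turns it into a free homotopy along a null-homotopic loop. -/
theorem isSimpleSpace_of_isGottliebLoop (hX : ∀ (x : X) (γ : Path x x), IsGottliebLoop γ) :
    IsSimpleSpace X := by
  rintro x n - γ f g ⟨F, hF⟩
  obtain ⟨Γ, γ', h0, h1, hΓ, hh⟩ := hX x γ
  let δ : Path x x := ⟨⟨fun t => Γ (σ t, γ t), by fun_prop⟩, by simp [h1], by simp [h0]⟩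
  refine FreelyHomotopicAlong.homotopic_of_nullhomotopic (δ := δ) ⟨⟨⟨fun p => Γ (σ p.1, F p),
    by fun_prop⟩, fun y => by simp [h1], fun y => by simp [h0]⟩, fun t y hy => ?_⟩ ?_
  · change Γ (σ t, F (t, y)) = Γ (σ t, γ t)
    rw [hF t y hy]
  · have h := Path.homotopic_of_antidiagonal ⟨fun s => Γ (s.1, γ s.2), by fun_prop⟩ γ' γ δ
      (fun t => by simp [hΓ]) (fun t => by simp [h0]) (fun t => rfl)
    refine Path.Homotopic.symm (h.trans ?_)
    rw [← Path.Homotopic.Quotient.eq] at hh ⊢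
    simp [hh]

/-- If the loops of `X` are Gottlieb loops, then a deck transformation `φ` of a path connected
covering space is homotopic to the identity: lift a self-homotopy of the identity of `X` whose
trace is the projection of a path from a point `e` to `φ e`. -/
theorem homotopic_id_of_isGottliebLoop (hX : ∀ (x : X) (γ : Path x x), IsGottliebLoop γ)
    {E : Type u} [TopologicalSpace E] [PathConnectedSpace E] {q : E → X} (hq : IsCoveringMap q)
    (φ : C(E, E)) (hφ : ∀ e, q (φ e) = q e) : (ContinuousMap.id E).Homotopic φ := by
  obtain ⟨e⟩ : Nonempty E := inferInstance
  let ℓ := PathConnectedSpace.somePath e (φ e)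
  let γ : Path (q e) (q e) := (ℓ.map hq.continuous).cast rfl (hφ e).symm
  obtain ⟨Γ, δ, h0, h1, hΓ, hh⟩ := hX (q e) γ
  let P : C(I × E, X) := ⟨fun p => Γ (p.1, q p.2), by have := hq.continuous; fun_prop⟩
  have hP0 (a : E) : P (0, a) = q (ContinuousMap.id E a) := h0 _
  let L := hq.liftHomotopy P (ContinuousMap.id E) hP0
  have hL (t : I) (a : E) : q (L (t, a)) = Γ (t, q a) :=
    congrFun (hq.liftHomotopy_lifts P _ hP0) (t, a)
  have hL0 (a : E) : L (0, a) = a := hq.liftHomotopy_zero P _ hP0 a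
  -- The lifts of the homotopic loops `δ` and `γ` starting at `e` have the same end point.
  have hend : L (1, e) = φ e := by
    have e1 : (⟨fun t => L (t, e), by fun_prop⟩ : C(I, E)) =
        hq.liftPath δ.toContinuousMap e (by simp) := by
      rw [hq.eq_liftPath_iff']
      exact ⟨funext fun t => (hL t e).trans (hΓ t), hL0 e⟩
    have e2 : ℓ.toContinuousMap = hq.liftPath γ.toContinuousMap e (by simp) := by
      rw [hq.eq_liftPath_iff']
      exact ⟨funext fun t => rfl, by simp⟩
    have e3 := hq.liftPath_apply_one_eq_of_homotopicRel hh e (by simp) (by simp)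
    rw [← e1, ← e2] at e3
    simpa using e3
  have hL1 : (fun a => L (1, a)) = φ := by
    refine hq.eq_of_comp_eq (by fun_prop) φ.continuous ?_ e hend
    funext a
    simp only [Function.comp_apply, hL, h1, hφ]
  exact ⟨⟨L, hL0, fun a => congrFun hL1 a⟩⟩

theorem deckActsTriviallyOnHomology_of_isGottliebLoop
    (hX : ∀ (x : X) (γ : Path x x), IsGottliebLoop γ) : DeckActsTriviallyOnHomology X := by
  intro E _ _ q hq φ hφ n
  obtain ⟨K⟩ := homotopic_id_of_isGottliebLoop hX hq (φ : C(E, E)) hφ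
  have h : TopCat.Homotopy (𝟙 (TopCat.of E)) (TopCat.ofHom (φ : C(E, E))) := K
  have := h.congr_homologyMap_singularChainComplexFunctor
    (AddCommGrpCat.of (ULift.{u} ℤ)) n
  exact this.symm.trans (((AlgebraicTopology.singularHomologyFunctor AddCommGrpCat.{u} n).obj
    (AddCommGrpCat.of (ULift.{u} ℤ))).map_id (TopCat.of E))

theorem isStronglySimple_pathComponent (hX : ∀ (x : X) (γ : Path x x), IsGottliebLoop γ) (z : X) :
    IsStronglySimple (pathComponent z) where
  pathConnected := isPathConnected_iff_pathConnectedSpace.mp isPathConnected_pathComponent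
  simple := isSimpleSpace_of_isGottliebLoop (isGottliebLoop_pathComponent z hX)
  homology_trivial :=
    deckActsTriviallyOnHomology_of_isGottliebLoop (isGottliebLoop_pathComponent z hX)

end GottliebLoops


/-! ### Common refinements of points of simplices -/

section Refinement

/-- Two weights `a` on `{0, …, m}` and `b` on `{0, …, n}` have a common refinement if they are the
push-forwards along monotone maps of one weight `v` on some `{0, …, r}` with `r ≤ m + n`.
Geometrically, `(a, b)` then lies on the simplex of the product triangulation given by the two
monotone maps. -/
def HasCommonRefinement {m n : ℕ} (a : Fin (m + 1) → ℝ) (b : Fin (n + 1) → ℝ) : Prop :=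
  ∃ r ≤ m + n, ∃ (v : Fin (r + 1) → ℝ) (α : Fin (r + 1) →o Fin (m + 1))
    (β : Fin (r + 1) →o Fin (n + 1)), (∀ i, 0 ≤ v i) ∧
      (∀ j, ∑ i, (if α i = j then v i else 0) = a j) ∧
      (∀ j, ∑ i, (if β i = j then v i else 0) = b j)

theorem HasCommonRefinement.symm {m n : ℕ} {a : Fin (m + 1) → ℝ} {b : Fin (n + 1) → ℝ}
    (h : HasCommonRefinement a b) : HasCommonRefinement b a := by
  obtain ⟨r, hr, v, α, β, h0, hα, hβ⟩ := h
  exact ⟨r, by omega, v, β, α, h0, hβ, hα⟩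

theorem hasCommonRefinement_zero_left {n : ℕ} (a : Fin 1 → ℝ) (b : Fin (n + 1) → ℝ)
    (hb : ∀ i, 0 ≤ b i) (hab : ∑ i, a i = ∑ i, b i) : HasCommonRefinement (m := 0) a b := by
  refine ⟨n, by omega, b, ⟨fun _ => 0, fun _ _ _ => le_rfl⟩, OrderHom.id, hb, fun j => ?_, ?_⟩
  · obtain rfl : j = (0 : Fin 1) := Subsingleton.elim (α := Fin 1) j 0
    refine Eq.trans (Finset.sum_congr rfl fun i _ => if_pos rfl) ?_
    simpa using hab.symm
  · simp

/-- Splitting off the smaller one `a 0` of the two initial weights. -/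
theorem HasCommonRefinement.cons {m n : ℕ} {a : Fin (m + 2) → ℝ} {b : Fin (n + 1) → ℝ}
    (ha : 0 ≤ a 0)
    (h : HasCommonRefinement (Fin.tail a) (Fin.cons (b 0 - a 0) (Fin.tail b) : Fin (n + 1) → ℝ)) :
    HasCommonRefinement a b := by
  obtain ⟨r, hr, v, α, β, h0, hα, hβ⟩ := h
  have mα : Monotone (Fin.cons 0 (fun i => (α i).succ) : Fin (r + 2) → Fin (m + 2)) := by
    intro i j hij
    induction i using Fin.cases with
    | zero => simp
    | succ i =>
      induction j using Fin.cases with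
      | zero => simp at hij
      | succ j => simpa using α.monotone (Fin.succ_le_succ_iff.1 hij)
  have mβ : Monotone (Fin.cons 0 β : Fin (r + 2) → Fin (n + 1)) := by
    intro i j hij
    induction i using Fin.cases with
    | zero => simp
    | succ i =>
      induction j using Fin.cases with
      | zero => simp at hij
      | succ j => simpa using β.monotone (Fin.succ_le_succ_iff.1 hij)
  refine ⟨r + 1, by omega, Fin.cons (a 0) v, ⟨_, mα⟩, ⟨_, mβ⟩, ?_, ?_, ?_⟩
  · intro i
    induction i using Fin.cases with
    | zero => simpa using ha
    | succ i => simpa using h0 i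
  · intro j
    rw [Fin.sum_univ_succ]
    induction j using Fin.cases with
    | zero => simp
    | succ j =>
      have := hα j
      simp only [Fin.tail] at this
      simpa [Fin.succ_ne_zero, Fin.zero_eq_one_iff, (Fin.succ_ne_zero _).symm] using this
  · intro j
    rw [Fin.sum_univ_succ]
    have := hβ j
    induction j using Fin.cases with
    | zero =>
      rw [Fin.cons_zero] at this
      simp [this]
    | succ j =>
      rw [Fin.cons_succ] at this
      simpa [(Fin.succ_ne_zero _).symm, Fin.tail] using this

theorem hasCommonRefinement {m n : ℕ} (a : Fin (m + 1) → ℝ) (b : Fin (n + 1) → ℝ)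
    (ha : ∀ i, 0 ≤ a i) (hb : ∀ i, 0 ≤ b i) (hab : ∑ i, a i = ∑ i, b i) :
    HasCommonRefinement a b := by
  induction hN : m + n generalizing m n with
  | zero =>
    obtain rfl : m = 0 := by omega
    exact hasCommonRefinement_zero_left a b hb hab
  | succ N ih =>
    have step {m n : ℕ} (a : Fin (m + 2) → ℝ) (b : Fin (n + 1) → ℝ) (ha : ∀ i, 0 ≤ a i)
        (hb : ∀ i, 0 ≤ b i) (hab : ∑ i, a i = ∑ i, b i) (hN : m + n = N) (h : a 0 ≤ b 0) :
        HasCommonRefinement a b := by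
      refine .cons (ha 0) (ih _ _ (fun i => ha _) (fun i => ?_) ?_ hN)
      · induction i using Fin.cases with
        | zero => simpa using h
        | succ i => simpa [Fin.tail] using hb _
      · rw [Fin.sum_univ_succ, Fin.sum_univ_succ b] at hab
        rw [Fin.sum_univ_succ (Fin.cons _ _ : Fin (n + 1) → ℝ)]
        simp only [Fin.tail, Fin.cons_zero, Fin.cons_succ]
        linarith
    match m, n with
    | 0, n => exact hasCommonRefinement_zero_left a b hb hab
    | m, 0 => exact (hasCommonRefinement_zero_left b a ha hab.symm).symm
    | m + 1, n + 1 =>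
      rcases le_total (a 0) (b 0) with h | h
      · exact step a b ha hb hab (by omega) h
      · exact (step b a hb ha hab.symm (by omega) h).symm

theorem stdSimplex.map_apply_eq_sum {m n : ℕ} (f : Fin (m + 1) → Fin (n + 1))
    (v : stdSimplex ℝ (Fin (m + 1))) (j : Fin (n + 1)) :
    stdSimplex.map f v j = ∑ i, if f i = j then v i else 0 := by
  rw [stdSimplex.map_coe, FunOnFinite.linearMap_apply_apply, Finset.sum_filter]

/-- Any pair of points of topological simplices lies on a simplex of the product triangulation. -/
theorem stdSimplex.exists_map_eq_and_map_eq {m n : ℕ} (a : stdSimplex ℝ (Fin (m + 1)))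
    (b : stdSimplex ℝ (Fin (n + 1))) :
    ∃ r ≤ m + n, ∃ (v : stdSimplex ℝ (Fin (r + 1))) (α : Fin (r + 1) →o Fin (m + 1))
      (β : Fin (r + 1) →o Fin (n + 1)), stdSimplex.map α v = a ∧ stdSimplex.map β v = b := by
  obtain ⟨r, hr, v, α, β, h0, hα, hβ⟩ := hasCommonRefinement (a : Fin (m + 1) → ℝ) b a.2.1 b.2.1
    (a.2.2.trans b.2.2.symm)
  have hv : ∑ i, v i = 1 := by
    refine Eq.trans ?_ a.2.2
    refine Eq.trans ?_ (Finset.sum_congr rfl fun j _ => hα j)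
    rw [Finset.sum_comm]
    simp
  refine ⟨r, hr, ⟨v, h0, hv⟩, α, β, ?_, ?_⟩
  · apply Subtype.ext
    funext j
    exact (stdSimplex.map_apply_eq_sum _ _ _).trans (hα j)
  · apply Subtype.ext
    funext j
    exact (stdSimplex.map_apply_eq_sum _ _ _).trans (hβ j)

/-- Every point of a simplex is an interior point of a face. -/
theorem stdSimplex.exists_pos_map_eq {r : ℕ} (v : stdSimplex ℝ (Fin (r + 1))) :
    ∃ (s : ℕ) (u : stdSimplex ℝ (Fin (s + 1))) (δ : Fin (s + 1) →o Fin (r + 1)),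
      (∀ i, 0 < u i) ∧ stdSimplex.map δ u = v := by
  classical
  let S : Finset (Fin (r + 1)) := {i | v i ≠ 0}
  have hS : S.Nonempty := by
    by_contra h
    rw [Finset.not_nonempty_iff_eq_empty, Finset.filter_eq_empty_iff] at h
    have : ∑ i, v i = 0 := Finset.sum_eq_zero fun i hi => by simpa using h hi
    exact zero_ne_one (this.symm.trans v.2.2)
  obtain ⟨s, hs⟩ : ∃ s, S.card = s + 1 := ⟨S.card - 1, by have := hS.card_pos; omega⟩
  let δ := S.orderEmbOfFin hs
  have hsum (g : Fin (r + 1) → ℝ) : ∑ i, g (δ i) = ∑ i ∈ S, g i := by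
    rw [← Finset.sum_image (f := g) (g := δ) (s := Finset.univ) δ.injective.injOn]
    congr 1
    simp [δ]
  have hv0 (i) (hi : i ∉ S) : v i = 0 := by simpa [S] using hi
  refine ⟨s, ⟨fun i => v (δ i), fun i => v.2.1 _, ?_⟩, δ.toOrderHom, fun i => ?_, ?_⟩
  · rw [hsum v, ← v.2.2]
    exact Finset.sum_subset (Finset.subset_univ _) fun i _ hi => hv0 i hi
  · refine lt_of_le_of_ne (v.2.1 _) (Ne.symm ?_)
    exact (Finset.mem_filter.1 (S.orderEmbOfFin_mem hs i)).2
  · apply Subtype.ext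
    funext j
    refine (stdSimplex.map_apply_eq_sum _ _ _).trans ?_
    refine (hsum fun i => if i = j then v i else 0).trans ?_
    rw [Finset.sum_ite_eq' S j]
    split_ifs with h
    · rfl
    · exact (hv0 j h).symm

/-- A monotone map is determined by the image of a single interior point: its cumulative weights
determine the lower sets `{i | f i ≤ j}`. -/
theorem stdSimplex.orderHom_eq_of_map_eq {s m : ℕ} (u : stdSimplex ℝ (Fin (s + 1)))
    (hu : ∀ i, 0 < u i) (f g : Fin (s + 1) →o Fin (m + 1))
    (h : stdSimplex.map f u = stdSimplex.map g u) : f = g := by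
  have hsum (f : Fin (s + 1) →o Fin (m + 1)) (j : Fin (m + 1)) :
      ∑ k ∈ Finset.Iic j, stdSimplex.map f u k = ∑ i with f i ≤ j, u i := by
    simp only [stdSimplex.map_apply_eq_sum]
    rw [Finset.sum_comm, Finset.sum_filter]
    exact Finset.sum_congr rfl fun i _ => by simp
  have hle (f g : Fin (s + 1) →o Fin (m + 1)) (h : stdSimplex.map f u = stdSimplex.map g u)
      (i) : f i ≤ g i := by
    by_contra! hi
    have hss : ({k | f k ≤ g i} : Finset (Fin (s + 1))) ⊂ ({k | g k ≤ g i} : Finset _) := by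
      rw [Finset.ssubset_iff_of_subset]
      · exact ⟨i, by simp, by simpa using hi⟩
      · intro k hk
        simp only [Finset.mem_filter, Finset.mem_univ, true_and] at hk ⊢
        refine g.monotone (le_of_not_gt fun hik => ?_)
        exact absurd (f.monotone hik.le) (not_le.2 (hk.trans_lt hi))
    have := Finset.sum_lt_sum_of_subset hss.subset (i := i) (by simp) (by simpa using hi) (hu i)
      fun k _ _ => (hu k).le
    rw [← hsum, ← hsum, h] at this
    exact lt_irrefl _ this
  ext i : 2
  exact le_antisymm (hle f g h i) (hle g f h.symm i)

end Refinement


/-! ### Points and maps of the geometric realization -/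

section Realization

open SimplicialQuotient

/-- The topological simplex attached to `n : SimplexCategory`. -/
abbrev Simplex (n : SimplexCategory) : Type := stdSimplex ℝ (Fin (n.len + 1))

variable {K L : SSet.{u}} {Z : Type u} [TopologicalSpace Z]

/-- The characteristic map `Δⁿ → |K|` of an `n`-simplex `x` of `K`. -/
def charMap {n : SimplexCategory} (x : K.obj (op n)) : C(Simplex n, SSet.toTop.obj K) :=
  TopCat.toSSetObjEquiv _ (op n) ((sSetTopAdj.unit.app K).app (op n) x)

theorem charMap_map {m n : SimplexCategory} (f : m ⟶ n) (x : K.obj (op n)) (t : Simplex m) :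
    charMap (K.map f.op x) t = charMap x (stdSimplex.map f t) := by
  have h := ConcreteCategory.congr_hom ((sSetTopAdj.unit.app K).naturality f.op) x
  have h' : (sSetTopAdj.unit.app K).app (op m) (K.map f.op x) =
    (TopCat.toSSet.obj (SSet.toTop.obj K)).map f.op ((sSetTopAdj.unit.app K).app (op n) x) := h
  unfold charMap
  rw [h']
  rfl

theorem toTop_map_charMap (φ : K ⟶ L) {n : SimplexCategory} (x : K.obj (op n)) (t : Simplex n) :
    SSet.toTop.map φ (charMap x t) = charMap (φ.app (op n) x) t := by
  have h' : (sSetTopAdj.unit.app L).app (op n) (φ.app (op n) x) =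
      (TopCat.toSSet.map (SSet.toTop.map φ)).app (op n) ((sSetTopAdj.unit.app K).app (op n) x) := by
    have h := ConcreteCategory.congr_hom
      (NatTrans.congr_app (sSetTopAdj.unit.naturality φ) (op n)) x
    rw [NatTrans.comp_app, NatTrans.comp_app, ConcreteCategory.comp_apply,
      ConcreteCategory.comp_apply] at h
    exact h
  unfold charMap
  rw [h']
  rfl

theorem vertex_eq_charMap (v : K.obj (op ⦋0⦌)) : vertex K v = charMap v default := rfl

/-- Two maps out of a realization agree if they agree on all characteristic maps. -/
theorem toTop_hom_ext {Z : TopCat.{u}} {f g : SSet.toTop.obj K ⟶ Z}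
    (h : ∀ (n : SimplexCategory) (x : K.obj (op n)) (t : Simplex n),
      f (charMap x t) = g (charMap x t)) : f = g := by
  apply (sSetTopAdj.homEquiv K Z).injective
  ext n x
  apply (TopCat.toSSetObjEquiv Z n).injective
  ext t
  rw [Adjunction.homEquiv_unit, Adjunction.homEquiv_unit]
  exact h n.unop x t

/-- Every point of the realization lies in the image of a characteristic map. -/
theorem exists_charMap_eq (z : SSet.toTop.obj K) :
    ∃ (n : SimplexCategory) (x : K.obj (op n)) (t : Simplex n), charMap x t = z := by
  classical
  -- If `z` were outside all images, its indicator function, as a map to an indiscrete space, would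
  -- be continuous and agree with a constant map on all images.
  obtain ⟨P, _, a, b, hab⟩ : ∃ (P : TopCat.{u}) (_ : IndiscreteTopology P) (a b : P), a ≠ b :=
    ⟨@TopCat.of (ULift.{u} Bool) ⊤, @IndiscreteTopology.mk _ ⊤ rfl, ⟨true⟩, ⟨false⟩, by simp⟩
  by_contra hz
  let f : SSet.toTop.obj K ⟶ P := TopCat.ofHom ⟨fun w => if w = z then a else b,
    continuous_of_indiscreteTopology⟩
  let g : SSet.toTop.obj K ⟶ P := TopCat.ofHom ⟨fun _ => b, continuous_const⟩
  have hfg : f = g := toTop_hom_ext fun n x t => if_neg fun h => hz ⟨n, x, t, h⟩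
  exact hab ((if_pos rfl).symm.trans (ConcreteCategory.congr_hom hfg z))

/-- A compatible family of continuous maps on the simplices of `K` glues to the realization. -/
theorem exists_toTop_desc (c : ∀ n : SimplexCategory, K.obj (op n) → C(Simplex n, Z))
    (hc : ∀ (m n : SimplexCategory) (f : m ⟶ n) (x : K.obj (op n)) (t : Simplex m),
      c m (K.map f.op x) t = c n x (stdSimplex.map f t)) :
    ∃ d : C(SSet.toTop.obj K, Z), ∀ (n : SimplexCategory) (x : K.obj (op n)) (t : Simplex n),
      d (charMap x t) = c n x t := by
  let φ : K ⟶ TopCat.toSSet.obj (TopCat.of Z) :=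
    { app := fun n => TypeCat.ofHom fun x => (TopCat.toSSetObjEquiv (TopCat.of Z) n).symm
        (c n.unop x)
      naturality := fun n m f => by
        ext x
        apply (TopCat.toSSetObjEquiv (TopCat.of Z) m).injective
        ext t
        exact hc m.unop n.unop f.unop x t }
  refine ⟨((sSetTopAdj.homEquiv K (TopCat.of Z)).symm φ).hom, fun n x t => ?_⟩
  have h := (sSetTopAdj.homEquiv K (TopCat.of Z)).apply_symm_apply φ
  rw [Adjunction.homEquiv_unit] at h
  have h' := congrArg (fun ψ => TopCat.toSSetObjEquiv (TopCat.of Z) (op n) (ψ.app (op n) x) t) h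
  exact h'

/-- Every point of the realization is joined to a vertex. -/
theorem exists_joined_vertex (z : SSet.toTop.obj K) :
    ∃ v : K.obj (op ⦋0⦌), Joined (vertex K v) z := by
  obtain ⟨n, x, t, rfl⟩ := exists_charMap_eq z
  let f : ⦋0⦌ ⟶ n := SimplexCategory.const ⦋0⦌ n 0
  refine ⟨K.map f.op x, ?_⟩
  rw [vertex_eq_charMap, charMap_map]
  exact (PathConnectedSpace.joined _ t).map (charMap x).continuous

end Realization

/-! ### The covering of a product of simplices by simplices -/

/-- The simplices covering the product of two simplices: pairs of monotone maps. Degenerate ones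
and faces of others are included, which does no harm. -/
abbrev ProdCell (m n : ℕ) : Type :=
  Σ r : Fin (m + n + 1), (Fin (r.1 + 1) →o Fin (m + 1)) × (Fin (r.1 + 1) →o Fin (n + 1))

instance (m n : ℕ) : Finite (ProdCell m n) :=
  have (a b : ℕ) : Finite (Fin a →o Fin b) := DFunLike.finite _
  inferInstanceAs (Finite (Σ _ : Fin _, _ × _))

/-- The map covering the product of two simplices by the simplices of its triangulation. -/
def prodCellMap (m n : ℕ) : C(Σ i : ProdCell m n, stdSimplex ℝ (Fin (i.1.1 + 1)),
    stdSimplex ℝ (Fin (m + 1)) × stdSimplex ℝ (Fin (n + 1))) where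
  toFun w := (stdSimplex.map w.1.2.1 w.2, stdSimplex.map w.1.2.2 w.2)
  continuous_toFun := by
    refine continuous_sigma fun i => ?_
    have h₁ := stdSimplex.continuous_map (S := ℝ) i.2.1
    have h₂ := stdSimplex.continuous_map (S := ℝ) i.2.2
    exact h₁.prodMk h₂

theorem isQuotientMap_prodCellMap (m n : ℕ) : Topology.IsQuotientMap (prodCellMap m n) := by
  refine (prodCellMap m n).continuous.isClosedMap.isQuotientMap (prodCellMap m n).continuous ?_
  rintro ⟨a, b⟩
  obtain ⟨r, hr, v, f, g, hf, hg⟩ := stdSimplex.exists_map_eq_and_map_eq a b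
  exact ⟨⟨⟨⟨r, by omega⟩, f, g⟩, v⟩, Prod.ext hf hg⟩

/-! ### The action of a loop in `|X|` on `|Y|` -/

section Action

variable {X Y : SSet.{u}}

/-- A simplicial pairing `X × Y → Z`, in terms of simplices. -/
structure SimplicialPairing (X Y Z : SSet.{u}) where
  /-- The pairing of `n`-simplices. -/
  pair : ∀ n : SimplexCategory, X.obj (op n) → Y.obj (op n) → Z.obj (op n)
  map_pair : ∀ (m n : SimplexCategory) (f : m ⟶ n) (x : X.obj (op n)) (y : Y.obj (op n)),
    Z.map f.op (pair n x y) = pair m (X.map f.op x) (Y.map f.op y)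

namespace SimplicialPairing

variable {Z : SSet.{u}} (A : SimplicialPairing X Y Z) {m n : SimplexCategory}

/-- The point of `|Z|` with coordinate `v` in the simplex pairing the degenerate simplices `α^* x`
and `β^* y` depends only on the points `α_* v` and `β_* v`. -/
theorem charMap_eq_of_map_eq (x : X.obj (op m)) (y : Y.obj (op n)) {r r' : SimplexCategory}
    (α : r ⟶ m) (β : r ⟶ n) (α' : r' ⟶ m) (β' : r' ⟶ n) (v : Simplex r) (v' : Simplex r')
    (hα : stdSimplex.map α v = stdSimplex.map α' v')
    (hβ : stdSimplex.map β v = stdSimplex.map β' v') :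
    charMap (A.pair r (X.map α.op x) (Y.map β.op y)) v =
      charMap (A.pair r' (X.map α'.op x) (Y.map β'.op y)) v' := by
  -- Both points are described by an interior point `u` of a common refinement of `v` and `v'`.
  -- As `u` is interior, equal images of `u` force the monotone maps to be equal.
  obtain ⟨s, -, w, γ, γ', rfl, rfl⟩ := stdSimplex.exists_map_eq_and_map_eq v v'
  obtain ⟨k, u, δ, hu, rfl⟩ := stdSimplex.exists_pos_map_eq w
  let c : ⦋k⦌ ⟶ r := SimplexCategory.Hom.mk (a := ⦋k⦌) (γ.comp δ)
  let c' : ⦋k⦌ ⟶ r' := SimplexCategory.Hom.mk (a := ⦋k⦌) (γ'.comp δ)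
  have hc : stdSimplex.map γ (stdSimplex.map δ u) = stdSimplex.map c u :=
    stdSimplex.map_comp_apply _ _ _
  have hc' : stdSimplex.map γ' (stdSimplex.map δ u) = stdSimplex.map c' u :=
    stdSimplex.map_comp_apply _ _ _
  rw [hc, hc'] at hα hβ
  rw [hc, hc']
  have key {p : SimplexCategory} (f : r ⟶ p) (f' : r' ⟶ p)
      (h : stdSimplex.map f (stdSimplex.map c u) = stdSimplex.map f' (stdSimplex.map c' u)) :
      c ≫ f = c' ≫ f' := by
    rw [stdSimplex.map_comp_apply, stdSimplex.map_comp_apply] at h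
    apply SimplexCategory.Hom.ext
    exact stdSimplex.orderHom_eq_of_map_eq u hu (SimplexCategory.Hom.toOrderHom (c ≫ f))
      (SimplexCategory.Hom.toOrderHom (c' ≫ f')) h
  rw [← charMap_map, ← charMap_map, A.map_pair, A.map_pair]
  simp only [← Functor.map_comp_apply, ← op_comp]
  rw [key α α' hα, key β β' hβ]

/-- The product of two simplices maps to `|Z|` by pairing: a continuous map, because the product
is the quotient of the finitely many simplices of its triangulation. -/
theorem exists_prodMap (x : X.obj (op m)) (y : Y.obj (op n)) :
    ∃ P : C(Simplex m × Simplex n, SSet.toTop.obj Z),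
      ∀ (r : SimplexCategory) (α : r ⟶ m) (β : r ⟶ n) (v : Simplex r),
        P (stdSimplex.map α v, stdSimplex.map β v) =
          charMap (A.pair r (X.map α.op x) (Y.map β.op y)) v := by
  let α (i : ProdCell m.len n.len) : ⦋i.1.1⦌ ⟶ m := SimplexCategory.Hom.mk (a := ⦋i.1.1⦌) i.2.1
  let β (i : ProdCell m.len n.len) : ⦋i.1.1⦌ ⟶ n := SimplexCategory.Hom.mk (a := ⦋i.1.1⦌) i.2.2
  have hq := isQuotientMap_prodCellMap m.len n.len
  let c : C(Σ i : ProdCell m.len n.len, stdSimplex ℝ (Fin (i.1.1 + 1)), SSet.toTop.obj Z) :=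
    ⟨fun w => charMap (A.pair ⦋w.1.1.1⦌ (X.map (α w.1).op x) (Y.map (β w.1).op y)) w.2,
      continuous_sigma fun i => (charMap (A.pair ⦋i.1.1⦌ (X.map (α i).op x)
        (Y.map (β i).op y))).continuous⟩
  have hc (w) (r : SimplexCategory) (f : r ⟶ m) (g : r ⟶ n) (v : Simplex r)
      (h : prodCellMap m.len n.len w = (stdSimplex.map f v, stdSimplex.map g v)) :
      c w = charMap (A.pair r (X.map f.op x) (Y.map g.op y)) v :=
    A.charMap_eq_of_map_eq x y (α w.1) (β w.1) f g w.2 v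
      (congrArg Prod.fst h) (congrArg Prod.snd h)
  have hcq : Function.FactorsThrough c (prodCellMap m.len n.len) := fun w w' h =>
    hc w ⦋w'.1.1.1⦌ (α w'.1) (β w'.1) w'.2 h
  refine ⟨hq.lift c hcq, fun r f g v => ?_⟩
  obtain ⟨w, hw⟩ := hq.surjective (stdSimplex.map f v, stdSimplex.map g v)
  rw [← hw]
  exact (ContinuousMap.congr_fun (hq.lift_comp c hcq) w).trans (hc w r f g v hw)

/-- The realization of a simplicial pairing on a product of simplices. -/
def prodMap (x : X.obj (op m)) (y : Y.obj (op n)) : C(Simplex m × Simplex n, SSet.toTop.obj Z) :=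
  (A.exists_prodMap x y).choose

theorem prodMap_map_map (x : X.obj (op m)) (y : Y.obj (op n)) {r : SimplexCategory}
    (α : r ⟶ m) (β : r ⟶ n) (v : Simplex r) :
    A.prodMap x y (stdSimplex.map α v, stdSimplex.map β v) =
      charMap (A.pair r (X.map α.op x) (Y.map β.op y)) v :=
  (A.exists_prodMap x y).choose_spec r α β v

theorem prodMap_naturality {m' n' : SimplexCategory} (f : m' ⟶ m) (g : n' ⟶ n)
    (x : X.obj (op m)) (y : Y.obj (op n)) (a : Simplex m') (b : Simplex n') :
    A.prodMap (X.map f.op x) (Y.map g.op y) (a, b) =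
      A.prodMap x y (stdSimplex.map f a, stdSimplex.map g b) := by
  obtain ⟨r, -, v, α, β, rfl, rfl⟩ := stdSimplex.exists_map_eq_and_map_eq a b
  let α' : ⦋r⦌ ⟶ m' := SimplexCategory.Hom.mk (a := ⦋r⦌) α
  let β' : ⦋r⦌ ⟶ n' := SimplexCategory.Hom.mk (a := ⦋r⦌) β
  have h1 := A.prodMap_map_map (X.map f.op x) (Y.map g.op y) α' β' v
  have h2 := A.prodMap_map_map x y (α' ≫ f) (β' ≫ g) v
  rw [op_comp, op_comp, Functor.map_comp_apply, Functor.map_comp_apply, ← h1] at h2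
  refine h2.symm.trans ?_
  rw [stdSimplex.map_comp_apply, stdSimplex.map_comp_apply]
  rfl

/-- A path in `|X|` acts on `|Y|` with values in `|Z|`. The action is only asserted along a path:
it is continuous in both variables because products with the compact interval and with simplices
preserve the colimits defining `|X|` and `|Y|`; a map on `|X| × |Y|` need not be continuous. -/
theorem exists_pathAction (γ : C(unitInterval, SSet.toTop.obj X)) :
    ∃ Γ : C(unitInterval × SSet.toTop.obj Y, SSet.toTop.obj Z),
      ∀ (t : unitInterval) (m n : SimplexCategory) (x : X.obj (op m)) (a : Simplex m)
        (y : Y.obj (op n)) (b : Simplex n), γ t = charMap x a →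
          Γ (t, charMap y b) = A.prodMap x y (a, b) := by
  have hB (n : SimplexCategory) (y : Y.obj (op n)) :
      ∃ B : C(SSet.toTop.obj X, C(Simplex n, SSet.toTop.obj Z)),
        ∀ (m : SimplexCategory) (x : X.obj (op m)) (a : Simplex m),
          B (charMap x a) = (A.prodMap x y).curry a := by
    refine exists_toTop_desc (fun m x => (A.prodMap x y).curry) fun m' m f x a => ?_
    ext b
    have := A.prodMap_naturality f (𝟙 n) x y a b
    simpa using this
  choose B hB using hB
  obtain ⟨D, hD⟩ := exists_toTop_desc (K := Y) (Z := C(unitInterval, SSet.toTop.obj Z))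
    (fun n y => ContinuousMap.curry ⟨fun p : Simplex n × unitInterval => B n y (γ p.2) p.1,
      by fun_prop⟩) (fun n' n g y b => by
        ext t
        obtain ⟨m, x, a, hx⟩ := exists_charMap_eq (γ t)
        simp only [ContinuousMap.curry_apply, ContinuousMap.coe_mk, ← hx, hB]
        have := A.prodMap_naturality (𝟙 m) g x y a b
        simpa using this)
  refine ⟨⟨fun p => D p.2 p.1, by fun_prop⟩, fun t m n x a y b ht => ?_⟩
  simp only [ContinuousMap.coe_mk, hD, ContinuousMap.curry_apply, ht, hB]

end SimplicialPairing

end Action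


/-! ### Loops in the simplicial quotient -/

namespace SimplicialQuotient

section

variable {X : Type u} [TopologicalSpace X]

theorem ext_ev {n : SimplexCategoryᵒᵖ} {σ τ : (TopCat.toSSet.obj (TopCat.of X)).obj n}
    (h : ∀ t, ev σ t = ev τ t) : σ = τ :=
  (TopCat.toSSetObjEquiv (TopCat.of X) n).injective (ContinuousMap.ext h)

theorem ev_vertex (g : X) (t) : ev (TopCat.toSSetObj₀Equiv (X := TopCat.of X).symm g) t = g :=
  rfl

theorem ev_map {m n : SimplexCategory} (f : m ⟶ n)
    (σ : (TopCat.toSSet.obj (TopCat.of X)).obj (op n)) (t) :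
    ev ((TopCat.toSSet.obj (TopCat.of X)).map f.op σ) t = ev σ (stdSimplex.map f t) :=
  rfl

end

variable {G : Type u} [Group G] [TopologicalSpace G] [IsTopologicalGroup G] (H : Subgroup G)

/-- The pointwise product of two singular simplices of a topological group. -/
def mulSimplex {n : SimplexCategoryᵒᵖ} (σ τ : (TopCat.toSSet.obj (TopCat.of G)).obj n) :
    (TopCat.toSSet.obj (TopCat.of G)).obj n :=
  (TopCat.toSSetObjEquiv (TopCat.of G) n).symm
    ((TopCat.toSSetObjEquiv (TopCat.of G) n σ : C(_, G)) *
      (TopCat.toSSetObjEquiv (TopCat.of G) n τ : C(_, G)))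

theorem ev_mulSimplex {n : SimplexCategoryᵒᵖ} (σ τ : (TopCat.toSSet.obj (TopCat.of G)).obj n) (t) :
    ev (mulSimplex σ τ) t = ev σ t * ev τ t := by
  simp [ev, mulSimplex]

/-- The left action of `S(G)` on `S(G)/S(H)`. -/
def leftAction :
    SimplicialPairing (TopCat.toSSet.obj (TopCat.of G)) (quotSSet H) (quotSSet H) where
  pair n σ := Quotient.map (mulSimplex σ) (by
    rintro τ τ' ⟨η, h⟩
    exact ⟨η, fun t => by rw [ev_mulSimplex, ev_mulSimplex, h, mul_assoc]⟩)
  map_pair m n f σ k := by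
    induction k using Quotient.inductionOn with
    | h τ => rfl

theorem leftAction_pair_mk {n : SimplexCategory}
    (σ τ : (TopCat.toSSet.obj (TopCat.of G)).obj (op n)) :
    (leftAction H).pair n σ ((quotSSetMap H).app (op n) τ) =
      (quotSSetMap H).app (op n) (mulSimplex σ τ) :=
  rfl

theorem quotSSetMap_surjective {n : SimplexCategory} (k : (quotSSet H).obj (op n)) :
    ∃ τ, (quotSSetMap H).app (op n) τ = k :=
  Quotient.exists_rep k

theorem proj_charMap {n : SimplexCategory} (σ : (TopCat.toSSet.obj (TopCat.of G)).obj (op n)) (t) :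
    proj H (charMap σ t) = charMap ((quotSSetMap H).app (op n) σ) t :=
  toTop_map_charMap _ _ _

theorem proj_basePoint : proj H (basePoint G) = charMap ((quotSSetMap H).app (op ⦋0⦌)
    (TopCat.toSSetObj₀Equiv (X := TopCat.of G).symm (1 : G))) default :=
  proj_charMap H _ _

/-- Every loop at the base point of `G//H` that comes from a loop in `G^•` is a Gottlieb loop: the
loop in `G^•` acts on `G//H` from the left, and it moves the base point along its projection. -/
theorem isGottliebLoop_map_proj (γ : Path (basePoint G) (basePoint G)) :
    IsGottliebLoop (γ.map (proj H).continuous) := by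
  obtain ⟨Γ, hΓ⟩ := (leftAction H).exists_pathAction γ.toContinuousMap
  have h1 (t : unitInterval) (ht : γ t = basePoint G) (z) : Γ (t, z) = z := by
    obtain ⟨n, k, b, rfl⟩ := exists_charMap_eq z
    refine (hΓ t _ n _ default k b ht).trans ?_
    have h := (leftAction H).prodMap_map_map
      (TopCat.toSSetObj₀Equiv (X := TopCat.of G).symm (1 : G)) k
      (SimplexCategory.const n ⦋0⦌ 0) (𝟙 n) b
    have hb : stdSimplex.map (SimplexCategory.const n ⦋0⦌ 0) b = default := Subsingleton.elim _ _
    have hb' : stdSimplex.map (𝟙 n : n ⟶ n) b = b := stdSimplex.map_id_apply b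
    rw [hb, hb'] at h
    refine h.trans ?_
    refine congrArg (fun k => charMap k b) ?_
    obtain ⟨τ, rfl⟩ := quotSSetMap_surjective H k
    rw [op_id, Functor.map_id_apply, leftAction_pair_mk]
    refine congrArg ((quotSSetMap H).app (op n)) (ext_ev fun t => ?_)
    rw [ev_mulSimplex, ev_map, ev_vertex, one_mul]
  have h2 (t : unitInterval) : Γ (t, proj H (basePoint G)) = proj H (γ t) := by
    obtain ⟨m, σ, a, ha⟩ := exists_charMap_eq (γ t)
    rw [proj_basePoint, ← ha, proj_charMap]
    refine (hΓ t m ⦋0⦌ σ a _ default ha.symm).trans ?_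
    have h := (leftAction H).prodMap_map_map σ ((quotSSetMap H).app (op ⦋0⦌)
      (TopCat.toSSetObj₀Equiv (X := TopCat.of G).symm (1 : G)))
      (𝟙 m) (SimplexCategory.const m ⦋0⦌ 0) a
    have hb : stdSimplex.map (SimplexCategory.const m ⦋0⦌ 0) a = default := Subsingleton.elim _ _
    have hb' : stdSimplex.map (𝟙 m : m ⟶ m) a = a := stdSimplex.map_id_apply a
    rw [hb, hb'] at h
    refine h.trans ?_
    refine congrArg (fun k => charMap k a) ?_
    rw [op_id, Functor.map_id_apply]
    refine congrArg ((quotSSetMap H).app (op m)) (ext_ev fun t => ?_)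
    rw [ev_mulSimplex, ev_map, ev_vertex, mul_one]
  exact ⟨Γ, γ.map (proj H).continuous, h1 0 γ.source, h1 1 γ.target, h2, .refl _⟩

/-- Left translation by an element of `G` on `S(G)/S(H)`. -/
def leftTranslation (g : G) : quotSSet H ⟶ quotSSet H where
  app n := TypeCat.ofHom ((leftAction H).pair n.unop ((TopCat.toSSet.obj (TopCat.of G)).map
    (SimplexCategory.const n.unop ⦋0⦌ 0).op (TopCat.toSSetObj₀Equiv (X := TopCat.of G).symm g)))
  naturality m n f := by
    ext k
    obtain ⟨τ, rfl⟩ := quotSSetMap_surjective H k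
    rfl

theorem leftTranslation_mk (g : G) {n : SimplexCategory}
    (τ : (TopCat.toSSet.obj (TopCat.of G)).obj (op n)) :
    (leftTranslation H g).app (op n) ((quotSSetMap H).app (op n) τ) =
      (quotSSetMap H).app (op n) (mulSimplex ((TopCat.toSSet.obj (TopCat.of G)).map
        (SimplexCategory.const n ⦋0⦌ 0).op (TopCat.toSSetObj₀Equiv (X := TopCat.of G).symm g)) τ) :=
  rfl

theorem leftTranslation_comp_of_mul_eq_one {g h : G} (hgh : h * g = 1) :
    leftTranslation H g ≫ leftTranslation H h = 𝟙 _ := by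
  ext n k
  obtain ⟨τ, rfl⟩ := quotSSetMap_surjective H (n := n.unop) k
  refine congrArg ((quotSSetMap H).app n) (ext_ev fun t => ?_)
  rw [ev_mulSimplex, ev_mulSimplex, ev_map, ev_map, ev_vertex, ev_vertex, ← mul_assoc, hgh, one_mul]

/-- `G` acts on `G//H` by homeomorphisms. -/
def leftTranslationHomeo (g : G) : simplicialQuotient H ≃ₜ simplicialQuotient H :=
  TopCat.homeoOfIso (SSet.toTop.mapIso
    { hom := leftTranslation H g
      inv := leftTranslation H g⁻¹
      hom_inv_id := leftTranslation_comp_of_mul_eq_one H (by simp)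
      inv_hom_id := leftTranslation_comp_of_mul_eq_one H (by simp) })

/-- The translates of the base point are the vertices of `G//H`. -/
theorem exists_leftTranslationHomeo_basePoint (v : (quotSSet H).obj (op ⦋0⦌)) :
    ∃ g : G, leftTranslationHomeo H g (proj H (basePoint G)) = vertex _ v := by
  obtain ⟨τ, rfl⟩ := quotSSetMap_surjective H v
  refine ⟨ev τ default, ?_⟩
  rw [proj_basePoint, vertex_eq_charMap]
  refine (toTop_map_charMap (leftTranslation H _) _ _).trans ?_
  refine congrArg (fun k => charMap k default) ?_
  rw [leftTranslation_mk]
  refine congrArg ((quotSSetMap H).app (op ⦋0⦌)) (ext_ev fun t => ?_)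
  rw [ev_mulSimplex, ev_map, ev_vertex, ev_vertex, mul_one, Subsingleton.elim t default]

theorem isGottliebLoop_of_surjective
    (hsurj : Function.Surjective (FundamentalGroup.map (proj H) (basePoint G)))
    (z : simplicialQuotient H) (γ : Path z z) : IsGottliebLoop γ := by
  have h0 (γ : Path (proj H (basePoint G)) (proj H (basePoint G))) : IsGottliebLoop γ := by
    obtain ⟨p, hp⟩ := hsurj (FundamentalGroup.fromPath (Path.Homotopic.Quotient.mk γ))
    obtain ⟨γ', rfl⟩ := Path.Homotopic.Quotient.mk_surjective p
    obtain ⟨Γ, δ, h0, h1, hδ, hh⟩ := isGottliebLoop_map_proj H γ'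
    exact ⟨Γ, δ, h0, h1, hδ, hh.trans (Path.Homotopic.Quotient.exact hp)⟩
  obtain ⟨v, ⟨ℓ⟩⟩ := exists_joined_vertex z
  obtain ⟨g, hg⟩ := exists_leftTranslationHomeo_basePoint H v
  exact isGottliebLoop_of_path ℓ (isGottliebLoop_of_homeomorph _ hg h0) γ

end SimplicialQuotient

end

open SimplicialQuotient in
theorem proposition3p4 {G : Type u} [Group G] [TopologicalSpace G] [IsTopologicalGroup G]
    (H : Subgroup G)
    (hsurj : Function.Surjective (FundamentalGroup.map (proj H) (basePoint G))) :
    ∀ z : simplicialQuotient H, IsStronglySimple (pathComponent z) := by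
  exact isStronglySimple_pathComponent (isGottliebLoop_of_surjective H hsurj)
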